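/- Let $S^1=\mathbb R/\mathbb Z$, and let $\pi:\mathbb R^2\to S^1\times\mathbb R$, $\pi(\phi,I)=(\phi \bmod 1, I)$. Let $T=(T_\phi,T_I):\mathbb R^2\to\mathbb R^2$ be a $C^1$ diffeomorphism of the plane that is a lift of a $C^1$ diffeomorphism $\widehat T$ of the cylinder $S^1\times\mathbb R$ (that is, $\pi\circ T=\widehat T\circ\pi$), such that $\partial_I T_\phi>0$ everywhere, for every $\phi$ both $T_\phi(\phi,I)\to\pm\infty$ and $T_I(\phi,I)\to\pm\infty$ as $I\to\pm\infty$, and $$T_I(\phi+1,I)=T_I(\phi,I),\quad T_I(\phi,I+1)=T_I(\phi,I)+1,\quad T_\phi(\phi+1,I)=T_\phi(\phi,I)+1,\quad T_\phi(\phi,I+1)=T_\phi(\phi,I)+1$$ for all $(\phi,I)\in\mathbb R^2$ (the class of such $T$ is called $TQ$). Suppose that $\widehat T$ is $\mu$-exact for some Borel measure $\mu$ on the cylinder that is finite on compact sets, positive on nonempty open sets and absolutely continuous with respect to Lebesgue measure; this means that $\widehat T$ preserves $\mu$ and that $\mu(\widehat T(A)\setminus A)=\mu(A\setminus\widehat T(A))$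 for every open set $A\subset S^1\times\mathbb R$ that is homeomorphic to the cylinder and has compact boundary. Suppose also that $T$ has no rotational invariant circle (R.I.C.), i.e. there is no homotopically non-trivial simple closed curve $C\subset S^1\times\mathbb R$ with $\widehat T(C)=C$. Then for every integer $k\ge 1$ there are an integer $N>0$, a point $P=(\phi_P,I_P)\in[0,1]^2$ and an integer $s$ such that $$T^N(\phi_P,I_P)=(\phi_P+s,\,I_P^N)\quad\text{with}\quad I_P^N>I_P+k .$$ -/

import Mathlib

open MeasureTheory Filter

namespace TwistMap

/-- The cylinder `S¹ × ℝ = (ℝ/ℤ) × ℝ`, with coordinates `(φ, I)`. -/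
abbrev Cylinder : Type := UnitAddCircle × ℝ

/-- The universal covering `π : ℝ² → S¹ × ℝ`, `π (φ, I) = (φ mod 1, I)`. -/
def proj (z : ℝ × ℝ) : Cylinder := ((z.1 : UnitAddCircle), z.2)

/-- The plane map `f` is a lift of the cylinder map `F`. Since `proj` is onto, `F` is determined
by `f`: it is the map induced by `f`. -/
def IsLift (f : ℝ × ℝ → ℝ × ℝ) (F : Cylinder → Cylinder) : Prop :=
  ∀ z, F (proj z) = proj (f z)

/-- `f` is a `C¹` diffeomorphism of the plane onto itself. -/
def IsC1DiffeoPlane (f : ℝ × ℝ → ℝ × ℝ) : Prop :=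
  ContDiff ℝ 1 f ∧
    ∃ g : ℝ × ℝ → ℝ × ℝ, ContDiff ℝ 1 g ∧ Function.LeftInverse g f ∧ Function.RightInverse g f

/-- `F` is a `C¹` map of the cylinder: read through the local diffeomorphism `proj`, it is given
near every point by a `C¹` map of the plane. -/
def IsC1Cylinder (F : Cylinder → Cylinder) : Prop :=
  ∀ z : ℝ × ℝ, ∃ g : ℝ × ℝ → ℝ × ℝ, ContDiffAt ℝ 1 g z ∧
    ∀ᶠ w in nhds z, F (proj w) = proj (g w)

/-- `F` is a `C¹` diffeomorphism of the cylinder onto itself. -/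
def IsC1DiffeoCylinder (F : Cylinder → Cylinder) : Prop :=
  IsC1Cylinder F ∧
    ∃ G : Cylinder → Cylinder,
      IsC1Cylinder G ∧ Function.LeftInverse G F ∧ Function.RightInverse G F

/-- The set `D_r^1(ℝ²)` of lifts of right twist `C¹` diffeomorphisms of the cylinder. -/
structure IsTwistLift (f : ℝ × ℝ → ℝ × ℝ) : Prop where
  diffeo : IsC1DiffeoPlane f
  vert_top : ∀ φ : ℝ, Tendsto (fun I : ℝ => (f (φ, I)).2) atTop atTop
  vert_bot : ∀ φ : ℝ, Tendsto (fun I : ℝ => (f (φ, I)).2) atBot atBot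
  twist : ∀ φ I : ℝ, 0 < deriv (fun t : ℝ => (f (φ, t)).1) I
  horiz_top : ∀ φ : ℝ, Tendsto (fun I : ℝ => (f (φ, I)).1) atTop atTop
  horiz_bot : ∀ φ : ℝ, Tendsto (fun I : ℝ => (f (φ, I)).1) atBot atBot
  lift : ∃ F : Cylinder → Cylinder, IsC1DiffeoCylinder F ∧ IsLift f F

/-- The set `TQ` of lifts of twist maps of the torus: elements `T = (T_φ, T_I)` of `D_r^1(ℝ²)`
satisfying the four periodicity relations. -/
def TQ : Set (ℝ × ℝ → ℝ × ℝ) :=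
  {T | IsTwistLift T ∧
    (∀ φ I : ℝ, (T (φ + 1, I)).2 = (T (φ, I)).2) ∧
    (∀ φ I : ℝ, (T (φ, I + 1)).2 = (T (φ, I)).2 + 1) ∧
    (∀ φ I : ℝ, (T (φ + 1, I)).1 = (T (φ, I)).1 + 1) ∧
    (∀ φ I : ℝ, (T (φ, I + 1)).1 = (T (φ, I)).1 + 1)}

/-- `F` is `μ`-exact. The measure `μ` on the cylinder is finite on compact sets, positive on
nonempty open sets and absolutely continuous with respect to Lebesgue measure; `F` preserves `μ`,
and the net `μ`-flux through `A` vanishes for all open sets `A` homeomorphic to the cylinder.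
Only sets `A` with compact frontier are tested (such as the region below an essential simple
closed curve): for a set `A` whose frontier reaches an end of the cylinder the equality may fail
although `F` is an exact area-preserving map. -/
structure IsExact (μ : Measure Cylinder) (F : Cylinder → Cylinder) : Prop where
  finite_compact : ∀ K : Set Cylinder, IsCompact K → μ K < ⊤
  pos_open : ∀ U : Set Cylinder, IsOpen U → U.Nonempty → 0 < μ U
  abs_cont : μ ≪ (volume : Measure Cylinder)
  invariant : MeasurePreserving F μ μ
  flux : ∀ A : Set Cylinder, IsOpen A → Nonempty (A ≃ₜ Cylinder) → IsCompact (frontier A) →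
    μ (F '' A \ A) = μ (A \ F '' A)

/-- `C` is a rotational invariant circle of the cylinder map `F`: a simple closed curve on the
cylinder that is not homotopic to a point, with `F(C) = C`. -/
def IsRIC (F : Cylinder → Cylinder) (C : Set Cylinder) : Prop :=
  (∃ γ : C(UnitAddCircle, Cylinder),
    Function.Injective γ ∧ ¬ γ.Nullhomotopic ∧ Set.range γ = C) ∧ F '' C = C

end TwistMap

/-!
Follow the images of the lower half plane. If they reach arbitrarily high, the image of some
vertical segment stays high and has large vertical extent. Either this image already moves
horizontally by `1`, or its ends are horizontally close and the twist separates them in one more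
step. In both cases a point of the segment returns to its vertical modulo `1`, far above its
starting height, and an integer translation brings it into the unit square.

If the images stay bounded, fill in everything below them. The twist prevents the upper envelope of
an image from jumping up when read from left to right, and this is exactly what makes the region
below an image be mapped into the region below the next one. The union of these regions is thus
mapped into itself; vanishing flux and the invariance of `μ` show that nothing of its interior is
lost, up to a null set, so the interior of its closure is invariant. Birkhoff's argument, which
compares the boundary with the images of verticals tilted to the right by the map and to the left
by its inverse, shows that this boundary is the graph of a continuous function: a rotational
invariant circle.
-/

namespace TwistMap

open Set Topology

section Order

variable {α β : Type*} [ConditionallyCompleteLinearOrder α] [DenselyOrdered α] [TopologicalSpace α]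
  [OrderTopology α] [LinearOrder β] [TopologicalSpace β] [OrderClosedTopology β] {f : α → β}

theorem nhdsGT_le_map_nhdsGT [NoMaxOrder α] (hf : Continuous f) (hm : StrictMono f) (a : α) :
    𝓝[>] (f a) ≤ map f (𝓝[>] a) := by
  intro s hs
  obtain ⟨b, hab, hbs⟩ := mem_nhdsGT_iff_exists_Ioo_subset.1 (mem_map.1 hs)
  filter_upwards [Ioo_mem_nhdsGT (hm hab)] with x hx
  obtain ⟨y, hy, rfl⟩ := intermediate_value_Ioo (le_of_lt hab) hf.continuousOn hx
  exact hbs hy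

theorem nhdsLT_le_map_nhdsLT [NoMinOrder α] (hf : Continuous f) (hm : StrictMono f) (a : α) :
    𝓝[<] (f a) ≤ map f (𝓝[<] a) :=
  nhdsGT_le_map_nhdsGT (α := αᵒᵈ) (β := βᵒᵈ) hf hm.dual a

theorem nhdsLT_le_map_nhdsGT [NoMaxOrder α] (hf : Continuous f) (hm : StrictAnti f) (a : α) :
    𝓝[<] (f a) ≤ map f (𝓝[>] a) :=
  nhdsGT_le_map_nhdsGT (β := βᵒᵈ) hf hm.dual_right a

theorem exists_last_eq {a b : α} (hab : a ≤ b) (hf : ContinuousOn f (Icc a b)) {h : β}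
    (ha : f a ≤ h) (hb : h ≤ f b) : ∃ c ∈ Icc a b, f c = h ∧ ∀ t ∈ Icc c b, h ≤ f t := by
  have hcompact : IsCompact (Icc a b ∩ f ⁻¹' {h}) :=
    isCompact_Icc.of_isClosed_subset (hf.preimage_isClosed_of_isClosed isClosed_Icc
      isClosed_singleton) inter_subset_left
  obtain ⟨c, ⟨hc, hch⟩, hmax⟩ :=
    hcompact.exists_isGreatest (intermediate_value_Icc hab hf ⟨ha, hb⟩)
  refine ⟨c, hc, hch, fun t ht => not_lt.1 fun hlt => ?_⟩
  obtain ⟨u, hu, huh⟩ := intermediate_value_Icc ht.2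
    (hf.mono (Icc_subset_Icc_left (hc.1.trans ht.1))) ⟨hlt.le, hb⟩
  have htc : t = c :=
    (hu.1.trans (hmax ⟨⟨hc.1.trans (ht.1.trans hu.1), hu.2⟩, huh⟩)).antisymm ht.1
  exact hlt.ne (htc ▸ hch)

end Order

theorem mem_iff_lt_csSup {α : Type*} [ConditionallyCompleteLinearOrder α] [DenselyOrdered α]
    [TopologicalSpace α] [OrderTopology α] [NoMaxOrder α] {s : Set α} (hopen : IsOpen s)
    (hlower : IsLowerSet s) (hne : s.Nonempty) (hbdd : BddAbove s) {a : α} :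
    a ∈ s ↔ a < sSup s := by
  refine ⟨fun ha => ?_, fun ha => ?_⟩
  · obtain ⟨b, hb, hab⟩ :=
      (((hopen.eventually_mem ha).filter_mono nhdsWithin_le_nhds).and
        (self_mem_nhdsWithin (s := Ioi a))).exists
    exact lt_csSup_of_lt hbdd hb hab
  · obtain ⟨b, hb, hab⟩ := exists_lt_of_lt_csSup hne ha
    exact hlower hab.le hb

theorem exists_add_int_mem_uIcc {R : Type*} [Field R] [LinearOrder R] [IsStrictOrderedRing R]
    [FloorRing R] {p q : R} (h : 1 ≤ |q - p|) (c : R) : ∃ s : ℤ, c + s ∈ uIcc p q := by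
  have hlen := max_sub_min_eq_abs p q
  exact ⟨⌈min p q - c⌉, by linarith [Int.le_ceil (min p q - c)],
    by linarith [Int.ceil_lt_add_one (min p q - c)]⟩

theorem exists_norm_le_of_periodic {E : Type*} [SeminormedAddCommGroup E] {f : ℝ × ℝ → E}
    (hf : Continuous f) (h₁ : Function.Periodic f (1, 0)) (h₂ : Function.Periodic f (0, 1)) :
    ∃ C, ∀ z, ‖f z‖ ≤ C := by
  obtain ⟨C, hC⟩ := ((isCompact_Icc (a := (0 : ℝ)) (b := 1)).prod
    (isCompact_Icc (a := (0 : ℝ)) (b := 1))).exists_bound_of_continuousOn hf.continuousOn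
  refine ⟨C, fun z => ?_⟩
  have hfract : z - ⌊z.1⌋ • (1, 0) - ⌊z.2⌋ • (0, 1) = (Int.fract z.1, Int.fract z.2) := by
    ext <;> simp
  rw [← h₁.sub_zsmul_eq ⌊z.1⌋, ← h₂.sub_zsmul_eq ⌊z.2⌋, hfract]
  exact hC _ ⟨unitInterval.fract_mem _, unitInterval.fract_mem _⟩

theorem image_interior_eq_of_subset_closure {X : Type*} [TopologicalSpace X] (e : X ≃ₜ X)
    {D : Set X} (hD : IsClosed D) (hle : e '' interior D ⊆ interior D)
    (hdense : interior D ⊆ closure (e '' interior D)) : e '' interior D = interior D := by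
  have hclosure : e '' closure (interior D) = closure (interior D) := by
    rw [e.image_closure]
    exact (closure_mono hle).antisymm (closure_minimal hdense isClosed_closure)
  have hregular : interior (closure (interior D)) = interior D :=
    (interior_mono (closure_minimal interior_subset hD)).antisymm
      (interior_maximal subset_closure isOpen_interior)
  rw [← hregular, e.image_interior, hclosure]

section Measure

variable {X : Type*} [MeasurableSpace X] {μ : Measure X}

theorem subset_closure_of_measure_diff_eq_zero [TopologicalSpace X] [μ.IsOpenPosMeasure]
    {U V : Set X} (hU : IsOpen U) (h : μ (U \ V) = 0) : U ⊆ closure V :=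
  sdiff_eq_empty.1 <| (hU.sdiff isClosed_closure).eq_empty_of_measure_zero <|
    measure_mono_null (sdiff_subset_sdiff_right subset_closure) h

theorem measure_diff_add_measure_diff_comm {U A B : Set X} (hA : MeasurableSet A)
    (hB : MeasurableSet B) (hAU : A ⊆ U) (hBU : B ⊆ U) :
    μ (U \ A) + μ (A \ B) = μ (U \ B) + μ (B \ A) := by
  have hsplit : ∀ {A B : Set X}, MeasurableSet A → A ⊆ U →
      μ (U \ A) + μ (A \ B) = μ (U \ (A ∩ B)) := fun {A B} hA hAU => by
    rw [add_comm, ← measure_inter_add_sdiff (U \ (A ∩ B)) hA]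
    congr 2 <;> grind
  rw [hsplit hA hAU, hsplit hB hBU, inter_comm]

theorem measure_diff_image_eq_zero_of_zero_flux {F : X → X} (hF : MeasurableEmbedding F)
    (hμ : MeasurePreserving F μ μ) {U B : Set X} (hU : MeasurableSet U) (hB : MeasurableSet B)
    (hBU : B ⊆ U) (hfin : μ (U \ B) ≠ ⊤) (hFU : F '' U ⊆ U)
    (hflux : μ (F '' B \ B) = μ (B \ F '' B)) : μ (U \ F '' U) = 0 := by
  have hFB : F '' B ⊆ F '' U := image_mono hBU
  have hFUm := hF.measurableSet_image.2 hU
  have hFBm := hF.measurableSet_image.2 hB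
  have hflux_fin : μ (F '' B \ B) ≠ ⊤ :=
    measure_ne_top_of_subset (sdiff_subset_sdiff_left (hFB.trans hFU)) hfin
  have hUFB : μ (U \ F '' B) = μ (U \ B) := by
    have h := measure_diff_add_measure_diff_comm (μ := μ) hFBm hB (hFB.trans hFU) hBU
    rwa [hflux, ENNReal.add_left_inj (hflux ▸ hflux_fin)] at h
  have hFUFB : μ (F '' U \ F '' B) = μ (U \ B) := by
    rw [← image_sdiff hF.injective, ← hμ.measure_preimage_emb hF,
      preimage_image_eq _ hF.injective]
  have h := measure_diff_add_measure_diff_comm (μ := μ) hFUm hFBm hFU (hFB.trans hFU)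
  rw [hFUFB, hUFB, sdiff_eq_empty.2 hFB, measure_empty, add_zero] at h
  exact (ENNReal.add_left_inj hfin).1 (h.trans (zero_add _).symm)

end Measure

theorem not_nullhomotopic_id_addCircle (p : ℝ) [hp : Fact (0 < p)] :
    ¬ (ContinuousMap.id (AddCircle p)).Nullhomotopic := by
  intro hnull
  have : ContractibleSpace (AddCircle p) := (contractible_iff_id_nullhomotopic _).2 hnull
  have hcov : IsCoveringMap ((↑) : ℝ → AddCircle p) := AddCircle.isCoveringMap_coe p
  have : LocallyPathConnectedSpace (AddCircle p) :=
    (hcov.isQuotientMap QuotientAddGroup.mk_surjective).locallyPathConnectedSpace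
  obtain ⟨f, ⟨hf0, hf⟩, -⟩ := hcov.existsUnique_continuousMap_lifts (ContinuousMap.id _)
    (a₀ := 0) (e₀ := 0) (by simp)
  have hlift : (fun x : ℝ => f x) = id :=
    hcov.eq_of_comp_eq (by fun_prop) continuous_id
      (funext fun x => congrFun hf x) 0 hf0
  have hperiod := congrFun hlift p
  simp only [AddCircle.coe_period, hf0, id] at hperiod
  exact hp.out.ne hperiod

/-- A homeomorphism of the plane that twists verticals to the right and commutes with integer
translations in the way the lifts of twist maps of the torus do. -/
structure IsTwistHomeo (e : (ℝ × ℝ) ≃ₜ (ℝ × ℝ)) : Prop where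
  mono : ∀ φ, StrictMono fun I : ℝ => (e (φ, I)).1
  add_fst : ∀ z, e (z + (1, 0)) = e z + (1, 0)
  add_snd : ∀ z, e (z + (0, 1)) = e z + (1, 1)

theorem exists_isTwistHomeo_of_mem_TQ {T : ℝ × ℝ → ℝ × ℝ} (hT : T ∈ TQ) :
    ∃ e : (ℝ × ℝ) ≃ₜ (ℝ × ℝ), (e : ℝ × ℝ → ℝ × ℝ) = T ∧ IsTwistHomeo e := by
  obtain ⟨hlift, hI_fst, hI_snd, hφ_fst, hφ_snd⟩ := hT
  obtain ⟨hTc, S, hSc, hl, hr⟩ := hlift.diffeo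
  refine ⟨⟨⟨T, S, hl, hr⟩, hTc.continuous, hSc.continuous⟩, rfl,
    fun φ => strictMono_of_deriv_pos (hlift.twist φ), ?_, ?_⟩
  · rintro ⟨x, y⟩
    exact Prod.ext (by simpa using hφ_fst x y) (by simpa using hI_fst x y)
  · rintro ⟨x, y⟩
    exact Prod.ext (by simpa using hφ_snd x y) (by simpa using hI_snd x y)

namespace IsTwistHomeo

variable {e : (ℝ × ℝ) ≃ₜ (ℝ × ℝ)} (he : IsTwistHomeo e)
include he

theorem apply_add_int (z : ℝ × ℝ) (m n : ℤ) :
    e (z + ((m : ℝ), (n : ℝ))) = e z + ((m : ℝ) + n, (n : ℝ)) := by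
  have h₁ := AddConstMapClass.map_add_zsmul
    (⟨e, he.add_fst⟩ : AddConstMap (ℝ × ℝ) (ℝ × ℝ) (1, 0) (1, 0)) z m
  have h₂ := AddConstMapClass.map_add_zsmul
    (⟨e, he.add_snd⟩ : AddConstMap (ℝ × ℝ) (ℝ × ℝ) (0, 1) (1, 1)) (z + m • (1, 0)) n
  have hz : z + ((m : ℝ), (n : ℝ)) = z + m • ((1 : ℝ), (0 : ℝ)) + n • ((0 : ℝ), (1 : ℝ)) := by
    ext <;> simp
  simp only [AddConstMap.coe_mk] at h₁ h₂
  rw [hz, h₂, h₁]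
  ext <;> simp [add_assoc]

theorem iterate_add_int (N : ℕ) (z : ℝ × ℝ) (m n : ℤ) :
    e^[N] (z + ((m : ℝ), (n : ℝ))) = e^[N] z + ((m : ℝ) + N * n, (n : ℝ)) := by
  induction N generalizing z m with
  | zero => simp
  | succ N ih =>
    rw [Function.iterate_succ_apply, Function.iterate_succ_apply, he.apply_add_int,
      ← Int.cast_add, ih]
    push_cast
    congr 2
    ring

theorem symm_add_snd (z : ℝ × ℝ) : e.symm (z + (0, 1)) = e.symm z + (-1, 1) := by
  have h := he.apply_add_int (e.symm z) (-1) 1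
  rw [Homeomorph.symm_apply_eq]
  simpa using h.symm

theorem strictAnti_symm (φ : ℝ) : StrictAnti fun I : ℝ => (e.symm (φ, I)).1 := by
  have hcont : Continuous fun I : ℝ => (e.symm (φ, I)).1 := by fun_prop
  have hinj : Function.Injective fun I : ℝ => (e.symm (φ, I)).1 := by
    intro a b hab
    have hfst : ∀ I, (e ((e.symm (φ, I)).1, (e.symm (φ, I)).2)).1 = φ := fun I =>
      congrArg Prod.fst (e.apply_symm_apply (φ, I))
    have hsnd : (e.symm (φ, a)).2 = (e.symm (φ, b)).2 :=
      (he.mono (e.symm (φ, a)).1).injective <|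
        (hfst a).trans (by rw [show (e.symm (φ, a)).1 = _ from hab]; exact (hfst b).symm)
    exact congrArg Prod.snd (e.symm.injective (Prod.ext hab hsnd))
  refine (hcont.strictMono_of_inj hinj).resolve_left fun hmono => ?_
  have hlt := hmono (zero_lt_one' ℝ)
  have hshift := congrArg Prod.fst (he.symm_add_snd (φ, 0))
  simp only [Prod.mk_add_mk, add_zero, zero_add, Prod.fst_add] at hshift hlt
  linarith

theorem exists_abs_snd_sub_le : ∃ C, ∀ z, |(e z).2 - z.2| ≤ C :=
  exists_norm_le_of_periodic (f := fun z => (e z).2 - z.2) (by fun_prop)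
    (fun z => by simp [he.add_fst]) (fun z => by simp [he.add_snd])

theorem exists_abs_fst_sub_le : ∃ C, ∀ z, |(e z).1 - (z.1 + z.2)| ≤ C :=
  exists_norm_le_of_periodic (f := fun z => (e z).1 - (z.1 + z.2)) (by fun_prop)
    (fun z => by simp [he.add_fst]; ring) (fun z => by simp [he.add_snd]; ring)

theorem bddAbove_snd_image {A : Set (ℝ × ℝ)} (hA : BddAbove (Prod.snd '' A)) :
    BddAbove (Prod.snd '' (e '' A)) := by
  obtain ⟨C, hC⟩ := he.exists_abs_snd_sub_le
  obtain ⟨M, hM⟩ := hA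
  refine ⟨M + C, ?_⟩
  rintro _ ⟨_, ⟨z, hz, rfl⟩, rfl⟩
  linarith [hM (mem_image_of_mem _ hz), (abs_le.1 (hC z)).2]

end IsTwistHomeo

/-- The points lying on or below a point of `A` on the same vertical. Its fibres stand in for the
upper envelope of `A`, which need not be a function with values in `ℝ`. -/
def shadow {α : Type*} (A : Set (α × ℝ)) : Set (α × ℝ) := {z | ∃ w ∈ A, w.1 = z.1 ∧ z.2 ≤ w.2}

section Shadow

variable {α : Type*} {A : Set (α × ℝ)}

theorem subset_shadow : A ⊆ shadow A := fun z hz => ⟨z, hz, rfl, le_rfl⟩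

theorem mem_shadow_of_le {x : α} {i j : ℝ} (h : (x, j) ∈ shadow A) (hij : i ≤ j) :
    (x, i) ∈ shadow A :=
  let ⟨w, hw, hfst, hsnd⟩ := h
  ⟨w, hw, hfst, hij.trans hsnd⟩

theorem bddAbove_snd_shadow (hA : BddAbove (Prod.snd '' A)) :
    BddAbove (Prod.snd '' shadow A) := by
  obtain ⟨M, hM⟩ := hA
  refine ⟨M, ?_⟩
  rintro _ ⟨z, ⟨w, hw, -, hzw⟩, rfl⟩
  exact hzw.trans (hM (mem_image_of_mem _ hw))

theorem isClosed_shadow [TopologicalSpace α] [FirstCountableTopology α] (hA : IsClosed A)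
    (hbdd : BddAbove (Prod.snd '' A)) : IsClosed (shadow A) := by
  obtain ⟨M, hM⟩ := hbdd
  refine IsSeqClosed.isClosed fun u z hu huz => ?_
  choose w hwA hw_fst hw_snd using hu
  have hu_fst : Tendsto (fun n => (u n).1) atTop (𝓝 z.1) := (continuous_fst.tendsto z).comp huz
  have hu_snd : Tendsto (fun n => (u n).2) atTop (𝓝 z.2) := (continuous_snd.tendsto z).comp huz
  obtain ⟨c, hc⟩ := hu_snd.bddBelow_range
  obtain ⟨a, -, θ, hθ, ha⟩ := isCompact_Icc.tendsto_subseq (x := fun n => (w n).2)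
    (s := Icc c M) fun n => ⟨(hc (mem_range_self n)).trans (hw_snd n),
      hM (mem_image_of_mem _ (hwA n))⟩
  have hlim : Tendsto (w ∘ θ) atTop (𝓝 (z.1, a)) := by
    have hfst : Tendsto (fun n => (w (θ n)).1) atTop (𝓝 z.1) := by
      simp only [hw_fst]
      exact hu_fst.comp hθ.tendsto_atTop
    exact hfst.prodMk_nhds ha
  exact ⟨(z.1, a), hA.mem_of_tendsto hlim (.of_forall fun n => hwA _), rfl,
    le_of_tendsto_of_tendsto' (hu_snd.comp hθ.tendsto_atTop) ha fun n => hw_snd _⟩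

theorem exists_isGreatest_fiber [TopologicalSpace α] (hA : IsClosed A)
    (hbdd : BddAbove (Prod.snd '' A)) {z : α × ℝ} (hz : z ∈ A) :
    ∃ s, IsGreatest {y | (z.1, y) ∈ A} s := by
  have hbdd_fiber : BddAbove {y | (z.1, y) ∈ A} :=
    hbdd.mono fun y (hy : (z.1, y) ∈ A) => mem_image_of_mem Prod.snd hy
  exact ⟨_, (hA.preimage (by fun_prop : Continuous fun y : ℝ => (z.1, y))).isGreatest_csSup
    ⟨z.2, hz⟩ hbdd_fiber⟩

end Shadow

/-- The upper envelope of `A` does not jump up when it is read from left to right: every height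
below a point of `A` is still below `A` slightly further to the left. It is the property of
envelopes that twist homeomorphisms propagate. -/
def NoUpwardJump (A : Set (ℝ × ℝ)) : Prop :=
  ∀ w ∈ A, ∀ h < w.2, ∀ᶠ x in 𝓝[<] w.1, (x, h) ∈ shadow A

/-- The `n`-th image of the closed lower half plane. Whether these sets are bounded above uniformly
in `n` separates the map with climbing orbits from the map with an invariant circle. -/
def lowerImage (f : ℝ × ℝ → ℝ × ℝ) (n : ℕ) : Set (ℝ × ℝ) := f^[n] '' {z | z.2 ≤ 0}

theorem lowerImage_zero (f : ℝ × ℝ → ℝ × ℝ) : lowerImage f 0 = {z | z.2 ≤ 0} := by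
  simp only [lowerImage, Function.iterate_zero, image_id]

theorem lowerImage_succ (f : ℝ × ℝ → ℝ × ℝ) (n : ℕ) :
    lowerImage f (n + 1) = f '' lowerImage f n := by
  simp only [lowerImage, Function.iterate_succ', image_comp]

theorem isClosed_lowerImage (e : (ℝ × ℝ) ≃ₜ (ℝ × ℝ)) (n : ℕ) : IsClosed (lowerImage e n) := by
  induction n with
  | zero => rw [lowerImage_zero]; exact isClosed_le continuous_snd continuous_const
  | succ n ih => rw [lowerImage_succ]; exact e.isClosedMap _ ih

namespace IsTwistHomeo

variable {e : (ℝ × ℝ) ≃ₜ (ℝ × ℝ)} (he : IsTwistHomeo e)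
include he

theorem image_shadow_subset {A : Set (ℝ × ℝ)} (hA : IsClosed A) (hbdd : BddAbove (Prod.snd '' A))
    (hjump : NoUpwardJump A) : e '' shadow A ⊆ shadow (e '' A) := by
  intro z hz
  obtain ⟨s, hs, hmax⟩ := exists_isGreatest_fiber (e.isClosedMap _ (isClosed_shadow hA hbdd))
    (he.bddAbove_snd_image (bddAbove_snd_shadow hbdd)) hz
  obtain ⟨v, ⟨w, hw, hwv, hvw⟩, hv⟩ := hs
  rcases hvw.eq_or_lt with heq | hlt
  · have hwe : e w = (z.1, s) := by rw [← hv, Prod.ext hwv heq.symm]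
    exact ⟨e w, mem_image_of_mem _ hw, by rw [hwe], by rw [hwe]; exact hmax hz⟩
  · exfalso
    -- Just above height `s` the preimage of the vertical moves left, where the envelope is high.
    set c : ℝ → ℝ × ℝ := fun y => e.symm (z.1, y)
    have hc : Continuous c := by fun_prop
    have hcs : c s = v := e.symm_apply_eq.2 hv.symm
    obtain ⟨h, hvh, hhw⟩ := exists_between hlt
    have hleft : Tendsto (fun y => (c y).1) (𝓝[>] s) (𝓝[<] w.1) := by
      rw [hwv, ← hcs]
      exact tendsto_nhdsWithin_of_tendsto_nhds_of_eventually_within _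
        (hc.fst.tendsto' s _ rfl |>.mono_left nhdsWithin_le_nhds)
        (eventually_mem_nhdsWithin.mono fun y hy => he.strictAnti_symm z.1 hy)
    have hlow : ∀ᶠ y in 𝓝[>] s, (c y).2 < h :=
      ((hc.snd.tendsto' s v.2 (by rw [hcs])).mono_left nhdsWithin_le_nhds).eventually_lt_const hvh
    obtain ⟨y, hyA, hyh, hys⟩ :=
      ((hleft.eventually (hjump w hw h hhw)).and (hlow.and eventually_mem_nhdsWithin)).exists
    have hy : (z.1, y) ∈ e '' shadow A :=
      ⟨c y, mem_shadow_of_le hyA hyh.le, e.apply_symm_apply _⟩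
    exact (hmax hy).not_gt hys

theorem noUpwardJump_image {A : Set (ℝ × ℝ)} (hA : e '' shadow A ⊆ shadow (e '' A)) :
    NoUpwardJump (e '' A) := by
  rintro _ ⟨w, hw, rfl⟩ h hh
  have hc : Continuous fun I : ℝ => e (w.1, I) := by fun_prop
  refine nhdsLT_le_map_nhdsLT hc.fst (he.mono w.1) w.2 (mem_map.2 ?_)
  have hhigh : ∀ᶠ I in 𝓝[<] w.2, h < (e (w.1, I)).2 :=
    ((hc.snd.tendsto w.2).mono_left nhdsWithin_le_nhds).eventually_const_lt hh
  filter_upwards [hhigh, self_mem_nhdsWithin] with I hI hIw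
  exact mem_shadow_of_le (hA ⟨(w.1, I), ⟨w, hw, rfl, le_of_lt hIw⟩, rfl⟩) hI.le

theorem bddAbove_snd_lowerImage (n : ℕ) : BddAbove (Prod.snd '' lowerImage e n) := by
  induction n with
  | zero => exact ⟨0, by simp [lowerImage_zero, upperBounds]⟩
  | succ n ih => rw [lowerImage_succ]; exact he.bddAbove_snd_image ih

theorem noUpwardJump_lowerImage (n : ℕ) : NoUpwardJump (lowerImage e n) := by
  induction n with
  | zero =>
    rw [lowerImage_zero]
    exact fun w hw h hh => .of_forall fun x => subset_shadow (hh.le.trans hw)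
  | succ n ih =>
    rw [lowerImage_succ]
    exact he.noUpwardJump_image (he.image_shadow_subset (isClosed_lowerImage e n)
      (he.bddAbove_snd_lowerImage n) ih)

theorem image_shadow_lowerImage_subset (n : ℕ) :
    e '' shadow (lowerImage e n) ⊆ shadow (lowerImage e (n + 1)) := by
  rw [lowerImage_succ]
  exact he.image_shadow_subset (isClosed_lowerImage e n) (he.bddAbove_snd_lowerImage n)
    (he.noUpwardJump_lowerImage n)

theorem add_int_mem_lowerImage (n : ℕ) (m : ℤ) {z : ℝ × ℝ} (hz : z ∈ lowerImage e n) :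
    z + ((m : ℝ), 0) ∈ lowerImage e n := by
  obtain ⟨w, hw, rfl⟩ := hz
  exact ⟨w + ((m : ℝ), 0), by simpa using hw, by simpa using he.iterate_add_int n w m 0⟩

theorem exists_return_mem_unitSquare {N : ℕ} {P : ℝ × ℝ} {s : ℤ} {k : ℝ}
    (hfst : (e^[N] P).1 = P.1 + s) (hsnd : P.2 + k < (e^[N] P).2) :
    ∃ Q ∈ Icc (0 : ℝ) 1 ×ˢ Icc (0 : ℝ) 1,
      ∃ s' : ℤ, (e^[N] Q).1 = Q.1 + s' ∧ Q.2 + k < (e^[N] Q).2 := by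
  have hiter := he.iterate_add_int N P (-⌊P.1⌋) (-⌊P.2⌋)
  have hfract : P + (((-⌊P.1⌋ : ℤ) : ℝ), ((-⌊P.2⌋ : ℤ) : ℝ)) = (Int.fract P.1, Int.fract P.2) := by
    ext <;> simp [Int.fract, sub_eq_add_neg]
  refine ⟨P + (((-⌊P.1⌋ : ℤ) : ℝ), ((-⌊P.2⌋ : ℤ) : ℝ)), ?_, s - N * ⌊P.2⌋, ?_, ?_⟩
  · rw [hfract]
    exact ⟨unitInterval.fract_mem _, unitInterval.fract_mem _⟩
  · rw [hiter]
    simp only [Prod.fst_add, hfst]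
    push_cast
    ring
  · rw [hiter]
    simp only [Prod.snd_add]
    linarith

theorem exists_separation :
    ∃ D, ∀ v w : ℝ × ℝ, D ≤ w.2 - v.2 → 1 ≤ |w.1 - v.1| ∨ 1 ≤ |(e w).1 - (e v).1| := by
  obtain ⟨C, hC⟩ := he.exists_abs_fst_sub_le
  refine ⟨2 * C + 2, fun v w hvw => or_iff_not_imp_left.2 fun hnear => le_abs.2 (.inl ?_)⟩
  linarith [(abs_lt.1 (not_le.1 hnear)).1, (abs_le.1 (hC w)).1, (abs_le.1 (hC v)).2]

theorem exists_high_segment (h : ∀ L, ∃ n, ∃ z ∈ lowerImage e n, L < z.2) (b D : ℝ) :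
    ∃ n, ∃ φ a c : ℝ, a ≤ c ∧ c ≤ 0 ∧ (∀ t ∈ Icc a c, b ≤ (e^[n] (φ, t)).2) ∧
      D ≤ (e^[n] (φ, c)).2 - (e^[n] (φ, a)).2 := by
  obtain ⟨n, _, ⟨⟨φ, c⟩, hc, rfl⟩, hhigh⟩ := h (b + max D 0)
  have hp : Continuous fun t => (e^[n] (φ, t)).2 :=
    ((e.continuous.iterate n).comp (by fun_prop : Continuous fun t : ℝ => (φ, t))).snd
  set m := ⌈(e^[n] (φ, c)).2 - b⌉
  have hm : (e^[n] (φ, c)).2 - b ≤ m := Int.le_ceil _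
  have hdrop : (e^[n] (φ, c - m)).2 = (e^[n] (φ, c)).2 - m := by
    simpa [sub_eq_add_neg] using congrArg Prod.snd (he.iterate_add_int n (φ, c) 0 (-m))
  obtain ⟨a, ha, hab, hsegment⟩ := exists_last_eq (f := fun t => (e^[n] (φ, t)).2) (h := b)
    (by linarith [le_max_right D 0] : c - m ≤ c) hp.continuousOn (by linarith)
    (by linarith [le_max_right D 0])
  refine ⟨n, φ, a, c, ha.2, hc, hsegment, ?_⟩
  linarith [le_max_left D 0]

theorem exists_return_of_segment {N : ℕ} {φ a c k : ℝ} (hac : a ≤ c) (hc : c ≤ 0)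
    (hhigh : ∀ t ∈ Icc a c, k < (e^[N] (φ, t)).2)
    (hmove : 1 ≤ |(e^[N] (φ, c)).1 - (e^[N] (φ, a)).1|) :
    ∃ N : ℕ, 0 < N ∧ ∃ P ∈ Icc (0 : ℝ) 1 ×ˢ Icc (0 : ℝ) 1,
      ∃ s : ℤ, (e^[N] P).1 = P.1 + s ∧ P.2 + k < (e^[N] P).2 := by
  have hN : 0 < N := Nat.pos_of_ne_zero fun h => by simp [h] at hmove; linarith
  have hp : Continuous fun t => (e^[N] (φ, t)).1 :=
    ((e.continuous.iterate N).comp (by fun_prop : Continuous fun t : ℝ => (φ, t))).fst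
  obtain ⟨s, hs⟩ := exists_add_int_mem_uIcc hmove φ
  obtain ⟨t, ht, hts⟩ := intermediate_value_uIcc hp.continuousOn hs
  rw [uIcc_of_le hac] at ht
  exact ⟨N, hN, he.exists_return_mem_unitSquare (P := (φ, t)) hts
    (by linarith [hhigh t ht, ht.2])⟩

theorem exists_return_of_unbounded (h : ∀ L, ∃ n, ∃ z ∈ lowerImage e n, L < z.2) (k : ℝ) :
    ∃ N : ℕ, 0 < N ∧ ∃ P ∈ Icc (0 : ℝ) 1 ×ˢ Icc (0 : ℝ) 1,
      ∃ s : ℤ, (e^[N] P).1 = P.1 + s ∧ P.2 + k < (e^[N] P).2 := by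
  obtain ⟨C, hC⟩ := he.exists_abs_snd_sub_le
  obtain ⟨D, hD⟩ := he.exists_separation
  obtain ⟨n, φ, a, c, hac, hc, hhigh, hheight⟩ := he.exists_high_segment h (k + C + 1) D
  have hC₀ : 0 ≤ C := (abs_nonneg _).trans (hC 0)
  rcases hD _ _ hheight with hmove | hmove
  · exact he.exists_return_of_segment hac hc (fun t ht => by linarith [hhigh t ht]) hmove
  · simp only [← Function.iterate_succ_apply' e n] at hmove
    refine he.exists_return_of_segment hac hc (fun t ht => ?_) hmove
    rw [Function.iterate_succ_apply']
    linarith [hhigh t ht, (abs_le.1 (hC (e^[n] (φ, t)))).1]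

end IsTwistHomeo

/-- A subset of the plane that is the lift of a region of the cylinder lying between two horizontal
circles and unbounded downwards along verticals; the lower circle is put at height `0`. -/
structure IsLowerRegion (A : Set (ℝ × ℝ)) : Prop where
  add_mem : ∀ z ∈ A, ∀ (m : ℤ) (t : ℝ), 0 ≤ t → z + ((m : ℝ), -t) ∈ A
  lower_subset : {z | z.2 < 0} ⊆ A
  bddAbove : BddAbove (Prod.snd '' A)

namespace IsLowerRegion

variable {A : Set (ℝ × ℝ)} (hA : IsLowerRegion A)
include hA

theorem mem_of_le {x i j : ℝ} (hij : i ≤ j) (hj : (x, j) ∈ A) : (x, i) ∈ A := by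
  simpa using hA.add_mem _ hj 0 (j - i) (sub_nonneg.2 hij)

theorem add_int_mem {z : ℝ × ℝ} (hz : z ∈ A) (m : ℤ) : z + ((m : ℝ), 0) ∈ A := by
  simpa using hA.add_mem z hz m 0 le_rfl

protected theorem interior : IsLowerRegion (interior A) where
  add_mem _ hz m t ht :=
    (isOpenMap_add_right _).mapsTo_interior (fun z hz => hA.add_mem z hz m t ht) hz
  lower_subset := interior_maximal hA.lower_subset (isOpen_lt continuous_snd continuous_const)
  bddAbove := hA.bddAbove.mono (image_mono interior_subset)

protected theorem closure : IsLowerRegion (closure A) where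
  add_mem _ hz m t ht :=
    map_mem_closure (f := (· + ((m : ℝ), -t))) (by fun_prop) hz fun z hz => hA.add_mem z hz m t ht
  lower_subset := hA.lower_subset.trans subset_closure
  bddAbove :=
    (bddAbove_closure.2 hA.bddAbove).mono (image_closure_subset_closure_image continuous_snd)

theorem exists_subgraph (hopen : IsOpen A) : ∃ G : ℝ → ℝ, LowerSemicontinuous G ∧
    Function.Periodic G 1 ∧ ∀ z, z ∈ A ↔ z.2 < G z.1 := by
  have hfiber : ∀ x y, (x, y) ∈ A ↔ y < sSup {i | (x, i) ∈ A} := fun x y => by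
    refine mem_iff_lt_csSup (hopen.preimage (by fun_prop : Continuous fun i : ℝ => (x, i)))
      (fun j i hij hj => hA.mem_of_le hij hj) ⟨-1, hA.lower_subset (by simp)⟩
      (hA.bddAbove.mono fun i (hi : (x, i) ∈ A) => mem_image_of_mem Prod.snd hi)
  refine ⟨fun x => sSup {i | (x, i) ∈ A}, ?_, fun x => ?_, fun z => hfiber z.1 z.2⟩
  · refine lowerSemicontinuous_iff_isOpen_preimage.2 fun y => ?_
    simp only [preimage, mem_Ioi, ← hfiber]
    exact hopen.preimage (by fun_prop)
  · have hshift : ∀ i, (x + 1, i) ∈ A ↔ (x, i) ∈ A := fun i =>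
      ⟨fun h => by simpa using hA.add_int_mem h (-1), fun h => by simpa using hA.add_int_mem h 1⟩
    simp only [hshift]

end IsLowerRegion

section Birkhoff

variable {f : ℝ × ℝ → ℝ × ℝ} {G : ℝ → ℝ}

theorem eventually_envelope_lt (hf : Continuous f)
    (hGf : ∀ z, (f z).2 < G (f z).1 ↔ z.2 < G z.1) {w : ℝ × ℝ} (hw : (f w).2 = G (f w).1) {b : ℝ}
    (hb : G (f w).1 < b) :
    ∀ᶠ x in map (fun I => (f (w.1, I)).1) (𝓝[>] w.2), G x < b := by
  have hc : Continuous fun I : ℝ => f (w.1, I) := by fun_prop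
  have hlow : ∀ᶠ I in 𝓝[>] w.2, (f (w.1, I)).2 < b :=
    ((hc.snd.tendsto w.2).mono_left nhdsWithin_le_nhds).eventually_lt_const (hw.trans_lt hb)
  have hGw : G w.1 ≤ w.2 := not_lt.1 ((hGf w).not.1 hw.not_lt)
  refine mem_map.2 ?_
  filter_upwards [hlow, self_mem_nhdsWithin] with I hI hwI
  exact (not_lt.1 ((hGf (w.1, I)).not.2 (hGw.trans (le_of_lt hwI)).not_gt)).trans_lt hI

theorem snd_eq_of_invariant_subgraph (hf : Continuous f) (hG : Continuous G)
    (hGf : ∀ z, (f z).2 < G (f z).1 ↔ z.2 < G z.1) {z : ℝ × ℝ} (hz : z.2 = G z.1) :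
    (f z).2 = G (f z).1 := by
  refine le_antisymm ?_ (not_lt.1 ((hGf z).not.2 hz.not_lt))
  have hc : Continuous fun I : ℝ => f (z.1, I) := by fun_prop
  refine le_of_tendsto_of_tendsto ((hc.snd.tendsto z.2).mono_left nhdsWithin_le_nhds)
    (((hG.comp hc.fst).tendsto z.2).mono_left nhdsWithin_le_nhds) (b := 𝓝[<] z.2) ?_
  filter_upwards [self_mem_nhdsWithin] with I hI
  exact ((hGf (z.1, I)).2 (lt_of_lt_of_eq hI hz)).le

namespace IsTwistHomeo

variable {e : (ℝ × ℝ) ≃ₜ (ℝ × ℝ)} (he : IsTwistHomeo e)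
include he

-- Points above the envelope stay above it under `e` and `e.symm`; since these maps tilt verticals
-- in opposite directions, the envelope is controlled from above on both sides of every point.
theorem continuous_of_invariant_subgraph (hG : LowerSemicontinuous G)
    (hGe : ∀ z, (e z).2 < G (e z).1 ↔ z.2 < G z.1) : Continuous G := by
  have hGsymm : ∀ z, (e.symm z).2 < G (e.symm z).1 ↔ z.2 < G z.1 := fun z => by
    rw [← hGe, e.apply_symm_apply]
  refine continuous_iff_lower_upperSemicontinuous.2 ⟨hG, fun x b hb => ?_⟩
  rw [← nhdsNE_sup_pure, ← nhdsLT_sup_nhdsGT, eventually_sup, eventually_sup]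
  refine ⟨⟨?_, ?_⟩, hb⟩
  · obtain ⟨w, hw⟩ := e.symm.surjective (x, G x)
    have h := nhdsLT_le_map_nhdsGT (by fun_prop) (he.strictAnti_symm w.1) w.2
    rw [Prod.mk.eta, hw] at h
    exact h (eventually_envelope_lt e.symm.continuous hGsymm (by rw [hw]) (by rwa [hw]))
  · obtain ⟨w, hw⟩ := e.surjective (x, G x)
    have h := nhdsGT_le_map_nhdsGT (by fun_prop) (he.mono w.1) w.2
    rw [Prod.mk.eta, hw] at h
    exact h (eventually_envelope_lt e.continuous hGe (by rw [hw]) (by rwa [hw]))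

theorem exists_invariant_periodic_graph {U : Set (ℝ × ℝ)} (hopen : IsOpen U)
    (hU : IsLowerRegion U) (heU : e '' U = U) : ∃ G : ℝ → ℝ, Continuous G ∧
      Function.Periodic G 1 ∧ e '' {z | z.2 = G z.1} = {z | z.2 = G z.1} := by
  obtain ⟨G, hG, hper, hUG⟩ := hU.exists_subgraph hopen
  have hGe : ∀ z, (e z).2 < G (e z).1 ↔ z.2 < G z.1 := fun z => by
    simpa only [heU, hUG] using e.injective.mem_set_image (s := U) (a := z)
  have hGsymm : ∀ z, (e.symm z).2 < G (e.symm z).1 ↔ z.2 < G z.1 := fun z => by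
    rw [← hGe, e.apply_symm_apply]
  have hcont := he.continuous_of_invariant_subgraph hG hGe
  refine ⟨G, hcont, hper, Subset.antisymm ?_ fun z hz => ⟨e.symm z, ?_, e.apply_symm_apply z⟩⟩
  · rintro _ ⟨z, hz, rfl⟩
    exact snd_eq_of_invariant_subgraph e.continuous hcont hGe hz
  · exact snd_eq_of_invariant_subgraph e.symm.continuous hcont hGsymm hz

theorem exists_isClosed_isLowerRegion {L : ℝ} (hL : ∀ n, ∀ z ∈ lowerImage e n, z.2 ≤ L) :
    ∃ D, IsClosed D ∧ IsLowerRegion D ∧ e '' D ⊆ D := by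
  have hregion : IsLowerRegion (⋃ n, shadow (lowerImage e n)) := by
    refine ⟨fun z hz m t ht => ?_, fun z hz => ?_, L, ?_⟩
    · obtain ⟨n, w, hw, hfst, hsnd⟩ := mem_iUnion.1 hz
      refine mem_iUnion.2 ⟨n, w + ((m : ℝ), 0), he.add_int_mem_lowerImage n m hw, ?_, ?_⟩
      · simp [hfst]
      · simp only [Prod.snd_add, add_zero]
        linarith
    · refine mem_iUnion.2 ⟨0, subset_shadow ?_⟩
      rw [lowerImage_zero]
      exact le_of_lt (show z.2 < 0 from hz)
    · rintro _ ⟨z, hz, rfl⟩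
      obtain ⟨n, w, hw, -, hzw⟩ := mem_iUnion.1 hz
      exact hzw.trans (hL n w hw)
  refine ⟨_, isClosed_closure, hregion.closure, ?_⟩
  rw [e.image_closure, image_iUnion]
  exact closure_mono (iUnion_subset fun n =>
    (he.image_shadow_lowerImage_subset n).trans (subset_iUnion_of_subset (n + 1) subset_rfl))

end IsTwistHomeo

end Birkhoff

theorem continuous_proj : Continuous proj :=
  ((AddCircle.continuous_mk' (1 : ℝ)).comp continuous_fst).prodMk continuous_snd

theorem isOpenMap_proj : IsOpenMap proj :=
  (QuotientAddGroup.isOpenMap_coe (N := AddSubgroup.zmultiples (1 : ℝ))).prodMap IsOpenMap.id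

theorem proj_surjective : Function.Surjective proj :=
  QuotientAddGroup.mk_surjective.prodMap Function.surjective_id

theorem proj_add_int (z : ℝ × ℝ) (m : ℤ) : proj (z + ((m : ℝ), 0)) = proj z := by
  simp [proj]

theorem exists_int_of_proj_eq {z w : ℝ × ℝ} (h : proj z = proj w) :
    ∃ m : ℤ, w = z + ((m : ℝ), 0) := by
  obtain ⟨hfst, hsnd⟩ := Prod.ext_iff.1 h
  obtain ⟨m, hm⟩ := AddSubgroup.mem_zmultiples_iff.1 (QuotientAddGroup.eq.1 hfst)
  refine ⟨m, Prod.ext ?_ ?_⟩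
  · simp only [zsmul_eq_mul, mul_one] at hm
    simp [hm]
  · exact hsnd.symm.trans (add_zero z.2).symm

theorem preimage_proj_image {X : Set (ℝ × ℝ)} (hX : ∀ z ∈ X, ∀ m : ℤ, z + ((m : ℝ), 0) ∈ X) :
    proj ⁻¹' (proj '' X) = X := by
  refine (subset_preimage_image proj X).antisymm' ?_
  rintro w ⟨z, hz, hzw⟩
  obtain ⟨m, rfl⟩ := exists_int_of_proj_eq hzw
  exact hX z hz m

namespace IsLift

variable {f : ℝ × ℝ → ℝ × ℝ} {F : Cylinder → Cylinder} (hF : IsLift f F)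
include hF

theorem image_proj_image (X : Set (ℝ × ℝ)) : F '' (proj '' X) = proj '' (f '' X) := by
  simp only [image_image, hF _]

theorem continuous (hf : Continuous f) : Continuous F :=
  (isOpenMap_proj.isQuotientMap continuous_proj proj_surjective).continuous_iff.2 <| by
    simpa only [Function.comp_def, hF _] using continuous_proj.comp hf

theorem isOpenMap (hf : IsOpenMap f) : IsOpenMap F := fun X hX => by
  rw [← image_preimage_eq X proj_surjective, hF.image_proj_image]
  exact isOpenMap_proj _ (hf _ (hX.preimage continuous_proj))

theorem injective (hf : Function.Injective f)
    (hadd : ∀ z (m : ℤ), f (z + ((m : ℝ), 0)) = f z + ((m : ℝ), 0)) : Function.Injective F := by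
  refine proj_surjective.forall.2 fun z => proj_surjective.forall.2 fun w hzw => ?_
  rw [hF, hF] at hzw
  obtain ⟨m, hm⟩ := exists_int_of_proj_eq hzw
  rw [hf (hm.trans (hadd z m).symm), proj_add_int]

end IsLift

/-- The part of the cylinder below the circle of height `0`. The net flux of an area-preserving map
through that circle is measured on this set. -/
def lowerHalf : Set Cylinder := {p | p.2 < 0}

/-- The lower half of the cylinder is a copy of the cylinder; this makes it one of the regions
tested in the definition of exactness. -/
noncomputable def lowerHalfHomeomorph : lowerHalf ≃ₜ Cylinder where
  toFun p := (p.1.1, Real.log (-p.1.2))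
  invFun q := ⟨(q.1, -Real.exp q.2), neg_neg_of_pos (Real.exp_pos _)⟩
  left_inv p := Subtype.ext <| Prod.ext rfl <| by
    simp only [Real.exp_log (neg_pos.2 p.2), neg_neg]
  right_inv q := by simp
  continuous_toFun := (by fun_prop : Continuous fun p : lowerHalf => p.1.1).prodMk
    (Continuous.log (by fun_prop) fun p => (neg_pos.2 p.2).ne')
  continuous_invFun := by fun_prop

theorem isOpen_lowerHalf : IsOpen lowerHalf := isOpen_lt continuous_snd continuous_const

theorem isCompact_slab (a b : ℝ) : IsCompact (Prod.snd ⁻¹' Icc a b : Set Cylinder) := by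
  rw [← univ_prod]
  exact isCompact_univ.prod isCompact_Icc

theorem isCompact_frontier_lowerHalf : IsCompact (frontier lowerHalf) :=
  (isCompact_slab 0 0).of_isClosed_subset isClosed_frontier fun p hp => by
    have hp₀ : p.2 = 0 := frontier_lt_subset_eq continuous_snd continuous_const hp
    simp [hp₀]

namespace IsExact

variable {F : Cylinder → Cylinder} {μ : Measure Cylinder} (h : IsExact μ F)
include h

theorem isFiniteMeasureOnCompacts : IsFiniteMeasureOnCompacts μ := ⟨h.finite_compact⟩

theorem isOpenPosMeasure : μ.IsOpenPosMeasure := ⟨fun U hU hne => (h.pos_open U hU hne).ne'⟩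

theorem flux_lowerHalf : μ (F '' lowerHalf \ lowerHalf) = μ (lowerHalf \ F '' lowerHalf) :=
  h.flux _ isOpen_lowerHalf ⟨lowerHalfHomeomorph⟩ isCompact_frontier_lowerHalf

end IsExact

theorem isRIC_graph {F : Cylinder → Cylinder} {g : UnitAddCircle → ℝ} (hg : Continuous g)
    (hF : F '' univ.graphOn g = univ.graphOn g) : IsRIC F (univ.graphOn g) := by
  refine ⟨⟨⟨fun x => (x, g x), by fun_prop⟩, fun x y h => congrArg Prod.fst h, fun hnull => ?_,
    graphOn_univ_eq_range.symm⟩, hF⟩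
  exact not_nullhomotopic_id_addCircle 1 (hnull.comp_right ⟨Prod.fst, continuous_fst⟩)

theorem image_proj_graph {G : ℝ → ℝ} (hG : Function.Periodic G 1) :
    proj '' {z | z.2 = G z.1} = univ.graphOn (hG.lift : UnitAddCircle → ℝ) := by
  refine Subset.antisymm ?_ ?_
  · rintro _ ⟨z, hz, rfl⟩
    exact ⟨z.1, mem_univ _, Prod.ext rfl ((hG.lift_coe z.1).trans (Eq.symm hz))⟩
  · rintro _ ⟨x, -, rfl⟩
    obtain ⟨φ, rfl⟩ := QuotientAddGroup.mk_surjective x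
    exact ⟨(φ, G φ), rfl, Prod.ext rfl (hG.lift_coe φ).symm⟩

theorem IsLowerRegion.measure_proj_image_diff_lowerHalf_lt_top {μ : Measure Cylinder}
    [IsFiniteMeasureOnCompacts μ] {A : Set (ℝ × ℝ)} (hA : IsLowerRegion A) :
    μ (proj '' A \ lowerHalf) < ⊤ := by
  obtain ⟨L, hL⟩ := hA.bddAbove
  refine (measure_mono ?_).trans_lt (isCompact_slab 0 L).measure_lt_top
  rintro _ ⟨⟨z, hz, rfl⟩, hz₀⟩
  exact ⟨not_lt.1 hz₀, hL (mem_image_of_mem _ hz)⟩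

section ZeroFlux

variable {e : (ℝ × ℝ) ≃ₜ (ℝ × ℝ)} {F : Cylinder → Cylinder} {μ : Measure Cylinder}
  [IsFiniteMeasureOnCompacts μ] [μ.IsOpenPosMeasure]

theorem IsTwistHomeo.subset_closure_image_of_zero_flux (he : IsTwistHomeo e) (hF : IsLift e F)
    (hinv : MeasurePreserving F μ μ)
    (hflux : μ (F '' lowerHalf \ lowerHalf) = μ (lowerHalf \ F '' lowerHalf)) {U : Set (ℝ × ℝ)}
    (hopen : IsOpen U) (hU : IsLowerRegion U) (heU : e '' U ⊆ U) : U ⊆ closure (e '' U) := by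
  have hadd : ∀ z (m : ℤ), e (z + ((m : ℝ), 0)) = e z + ((m : ℝ), 0) := fun z m => by
    simpa using he.apply_add_int z m 0
  have hFemb : IsOpenEmbedding F := .of_continuous_injective_isOpenMap
    (hF.continuous e.continuous) (hF.injective e.injective hadd) (hF.isOpenMap e.isOpenMap)
  have hlower : lowerHalf ⊆ proj '' U := by
    rw [← image_preimage_eq lowerHalf proj_surjective]
    exact image_mono hU.lower_subset
  have hVopen : IsOpen (proj '' U) := isOpenMap_proj _ hopen
  have hnull : μ (proj '' U \ F '' (proj '' U)) = 0 :=
    measure_diff_image_eq_zero_of_zero_flux hFemb.measurableEmbedding hinv hVopen.measurableSet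
      isOpen_lowerHalf.measurableSet hlower hU.measure_proj_image_diff_lowerHalf_lt_top.ne
      (by rw [hF.image_proj_image]; exact image_mono heU) hflux
  have hperiod : ∀ z ∈ e '' U, ∀ m : ℤ, z + ((m : ℝ), 0) ∈ e '' U := by
    rintro _ ⟨z, hz, rfl⟩ m
    exact ⟨_, hU.add_int_mem hz m, hadd z m⟩
  rw [← preimage_proj_image hperiod,
    ← isOpenMap_proj.preimage_closure_eq_closure_preimage continuous_proj, ← image_subset_iff,
    ← hF.image_proj_image]
  exact subset_closure_of_measure_diff_eq_zero hVopen hnull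

theorem IsTwistHomeo.exists_invariant_graph (he : IsTwistHomeo e) (hF : IsLift e F)
    (hinv : MeasurePreserving F μ μ)
    (hflux : μ (F '' lowerHalf \ lowerHalf) = μ (lowerHalf \ F '' lowerHalf)) {D : Set (ℝ × ℝ)}
    (hclosed : IsClosed D) (hD : IsLowerRegion D) (heD : e '' D ⊆ D) :
    ∃ g : UnitAddCircle → ℝ, Continuous g ∧ F '' univ.graphOn g = univ.graphOn g := by
  have hle : e '' interior D ⊆ interior D := by
    rw [e.image_interior]
    exact interior_mono heD
  have heq : e '' interior D = interior D := image_interior_eq_of_subset_closure e hclosed hle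
    (he.subset_closure_image_of_zero_flux hF hinv hflux isOpen_interior hD.interior hle)
  obtain ⟨G, hG, hper, hgraph⟩ :=
    he.exists_invariant_periodic_graph isOpen_interior hD.interior heq
  refine ⟨hper.lift, continuous_coinduced_dom.2 hG, ?_⟩
  rw [← image_proj_graph, hF.image_proj_image, hgraph]

end ZeroFlux

end TwistMap

theorem mainTheorem7_general {e : (ℝ × ℝ) ≃ₜ (ℝ × ℝ)} (he : TwistMap.IsTwistHomeo e)
    {F : TwistMap.Cylinder → TwistMap.Cylinder} (hF : TwistMap.IsLift e F)
    {μ : Measure TwistMap.Cylinder} [IsFiniteMeasureOnCompacts μ] [μ.IsOpenPosMeasure]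
    (hinv : MeasurePreserving F μ μ)
    (hflux : μ (F '' TwistMap.lowerHalf \ TwistMap.lowerHalf) =
      μ (TwistMap.lowerHalf \ F '' TwistMap.lowerHalf))
    (hgraph : ∀ g : UnitAddCircle → ℝ, Continuous g →
      F '' Set.univ.graphOn g ≠ Set.univ.graphOn g) (k : ℝ) :
    ∃ N : ℕ, 0 < N ∧ ∃ P ∈ Set.Icc (0 : ℝ) 1 ×ˢ Set.Icc (0 : ℝ) 1,
      ∃ s : ℤ, (e^[N] P).1 = P.1 + (s : ℝ) ∧ P.2 + k < (e^[N] P).2 := by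
  refine he.exists_return_of_unbounded (fun L => ?_) k
  by_contra! hL
  obtain ⟨D, hclosed, hD, heD⟩ := he.exists_isClosed_isLowerRegion hL
  obtain ⟨g, hg, hFg⟩ := he.exists_invariant_graph hF hinv hflux hclosed hD heD
  exact hgraph g hg hFg

theorem mainTheorem7 (T : ℝ × ℝ → ℝ × ℝ) (hT : T ∈ TwistMap.TQ)
    (That : TwistMap.Cylinder → TwistMap.Cylinder) (hThat : TwistMap.IsLift T That)
    (μ : MeasureTheory.Measure TwistMap.Cylinder) (hμ : TwistMap.IsExact μ That)
    (hRIC : ¬ ∃ C : Set TwistMap.Cylinder, TwistMap.IsRIC That C)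
    (k : ℕ) (hk : 0 < k) :
    ∃ N : ℕ, 0 < N ∧ ∃ P : ℝ × ℝ, P ∈ Set.Icc (0 : ℝ) 1 ×ˢ Set.Icc (0 : ℝ) 1 ∧
      ∃ s : ℤ, (T^[N] P).1 = P.1 + (s : ℝ) ∧ P.2 + (k : ℝ) < (T^[N] P).2 := by
  obtain ⟨e, rfl, he⟩ := TwistMap.exists_isTwistHomeo_of_mem_TQ hT
  have := hμ.isFiniteMeasureOnCompacts
  have := hμ.isOpenPosMeasure
  exact mainTheorem7_general he hThat hμ.invariant hμ.flux_lowerHalf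
    (fun g hg hFg => hRIC ⟨_, TwistMap.isRIC_graph hg hFg⟩) k
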